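/- Let $G$ be an infinite, simple, connected graph of bounded degree, rooted at a vertex $o$, and suppose that $G$ is non-amenable: $\Phi(G)=\inf_A |\partial A|/|A|>0$, where the infimum is over all nonempty finite sets $A$ of vertices and $\partial A=\{x\notin A:\exists\, y\in A,\ y\sim x\}$. For a finite set $A$ of vertices put $\mathrm{rad}(A)=\max\{\mathrm{dist}(o,x):x\in A\}$. Let $(X_t)_{t\ge 0}$ be the simple random walk on $G$, with law $\mathbb P_x$ when $X_0=x$, and let $T_A^+=\inf\{t\ge 1:X_t\in A\}$. The equilibrium measure, the capacity and the harmonic measure of $A$ are $$e_A(x)=\mathbf 1_{\{x\in A\}}\deg(x)\,\mathbb P_x[T_A^+=\infty],\qquad \mathrm{cap}(A)=\sum_x e_A(x),\qquad h_A(x)=\frac{e_A(x)}{\mathrm{cap}(A)}.$$ Let $(A_t)_{t\ge 0}$ be diffusion limited aggregation (DLA) on $G$ started at $A_0=\{o\}$, that is, the Markov chain on finite sets of vertices in which, given $A_t$, a random vertex $a_{t+1}\in\partial A_t$ is chosen to be $x$ with probability $h_{A_t\cup\partial A_t}(x)$, and $A_{t+1}=A_t\cup\{a_{t+1}\}$.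 Then, almost surely, $$0<\inf_{t>1}\,(\log t)^{-1}\,\mathrm{rad}(A_t)\le\limsup_{t\to\infty}\,(\log t)^{-1}\,\mathrm{rad}(A_t)<\infty ,$$ where $t$ ranges over the integers. -/

import Mathlib

open MeasureTheory ProbabilityTheory Filter

noncomputable section

namespace DLA

/-! ### Graph notions -/

section Graph

variable {V : Type*} (G : SimpleGraph V)

/-- The radius `rad(A) = max {dist(o, x) : x ∈ A}` of a finite set of vertices, seen from `o`. -/
def rad (o : V) (A : Finset V) : ℕ :=
  A.sup (fun x => G.dist o x)

variable [G.LocallyFinite]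

open Classical in
/-- The outer vertex boundary `∂A`: the vertices outside `A` with a neighbour in `A`. -/
def outerBoundary (A : Finset V) : Finset V :=
  A.biUnion (fun y => G.neighborFinset y) \ A

theorem mem_outerBoundary {A : Finset V} {x : V} :
    x ∈ outerBoundary G A ↔ x ∉ A ∧ ∃ y ∈ A, G.Adj x y := by
  classical
  simp [outerBoundary, G.adj_comm x, and_comm]

/-- The Cheeger constant `Φ(G) = inf |∂A| / |A|` over the nonempty finite sets `A` of vertices. -/
def cheegerConstant : ℝ :=
  ⨅ A : {A : Finset V // A.Nonempty}, ((outerBoundary G A.1).card : ℝ) / (A.1.card : ℝ)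

/-- A graph is non-amenable if its Cheeger constant is positive. -/
def IsNonamenable : Prop :=
  0 < cheegerConstant G

end Graph

/-! ### Simple random walk -/

section Walk

variable {V : Type*} (G : SimpleGraph V) [G.LocallyFinite]

/-- One step of the simple random walk: a uniformly chosen neighbour of `x`.
(At an isolated vertex, which an infinite connected graph does not have, the walk stays put.) -/
def walkStep (x : V) : PMF V :=
  open Classical in
  if h : (G.neighborFinset x).Nonempty then PMF.uniformOfFinset (G.neighborFinset x) h
  else PMF.pure x

variable [MeasurableSpace V] [DiscreteMeasurableSpace V]

/-- The transition kernel of the simple random walk. -/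
def walkKernel : Kernel V V where
  toFun x := (walkStep G x).toMeasure
  measurable' := Measurable.of_discrete

instance : IsMarkovKernel (walkKernel G) :=
  ⟨fun x => inferInstanceAs (IsProbabilityMeasure (walkStep G x).toMeasure)⟩

/-- The transition kernel of the walk at time `n`, as a kernel on histories up to time `n`; it
depends on the position at time `n` only. -/
def walkHistoryKernel (n : ℕ) : Kernel ((i : Finset.Iic n) → (fun _ : ℕ => V) i) V :=
  (walkKernel G).comap (fun h => h ⟨n, Finset.mem_Iic.2 le_rfl⟩) (measurable_pi_apply _)

instance (n : ℕ) : IsMarkovKernel (walkHistoryKernel G n) := by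
  unfold walkHistoryKernel
  infer_instance

/-- The law `ℙ_x` on `ℕ → V` of the simple random walk `(X_t)` started at `X_0 = x`. -/
def walkLaw (x : V) : Measure (ℕ → V) :=
  Kernel.traj (X := fun _ => V) (walkHistoryKernel G) 0 (fun _ => x)

/-- The positive hitting time `T_A⁺ = inf {t ≥ 1 : X_t ∈ A}` of a path `X`. -/
def returnTime {V : Type*} (A : Finset V) (X : ℕ → V) : ℕ∞ :=
  ⨅ (t : ℕ) (_ : 1 ≤ t ∧ X t ∈ A), (t : ℕ∞)

/-- The equilibrium measure `e_A(x) = 1{x ∈ A} deg(x) ℙ_x[T_A⁺ = ∞]`. -/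
def equilibriumMeasure (A : Finset V) (x : V) : ℝ :=
  open Classical in
  if x ∈ A then (G.degree x : ℝ) * (walkLaw G x).real {X | returnTime A X = ⊤} else 0

/-- The capacity `cap(A) = ∑ₓ e_A(x)`. -/
def capacity (A : Finset V) : ℝ :=
  ∑ x ∈ A, equilibriumMeasure G A x

/-- The harmonic measure from infinity `h_A(x) = e_A(x) / cap(A)`. -/
def harmonicMeasure (A : Finset V) (x : V) : ℝ :=
  equilibriumMeasure G A x / capacity G A

end Walk

/-! ### Diffusion limited aggregation -/

section Aggregation

variable {V : Type*} (G : SimpleGraph V) [G.LocallyFinite]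
  [MeasurableSpace V] [DiscreteMeasurableSpace V]

open Classical in
/-- The transition probability from `S` to `T` of DLA: a vertex `x ∈ ∂S` is chosen with
probability `h_{S ∪ ∂S}(x)`, and `S` is replaced by `S ∪ {x}`. -/
def dlaTransition (S T : Finset V) : ℝ :=
  ∑ x ∈ outerBoundary G S with insert x S = T,
    harmonicMeasure G (S ∪ outerBoundary G S) x

/-- `(A_t)` is DLA on `G` started at `A_0 = S₀`: a Markov chain on the finite sets of vertices,
with starting state `S₀` and transition probabilities `dlaTransition G`. -/
structure IsDLA (S₀ : Finset V) {Ω : Type*} [MeasurableSpace Ω] (μ : Measure Ω)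
    (A : ℕ → Ω → Finset V) : Prop where
  measurableSet_eq : ∀ (t : ℕ) (S : Finset V), MeasurableSet {ω | A t ω = S}
  start : ∀ᵐ ω ∂μ, A 0 ω = S₀
  markov : ∀ (t : ℕ) (S : ℕ → Finset V),
    μ.real {ω | ∀ i ≤ t + 1, A i ω = S i} =
      μ.real {ω | ∀ i ≤ t, A i ω = S i} * dlaTransition G (S t) (S (t + 1))

end Aggregation

end DLA

end

/-!
Lower bound: each step adds exactly one vertex, so `A_t` has `t + 1` vertices, while a ball of
radius `r` has at most `(D + 1) ^ r` vertices when all degrees are at most `D`.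

Upper bound: the heart of the matter is that harmonic measure is spread out. For a finite set `A`
let `h_n(x)` be the probability that the walk from `x` hits `A` within `n` steps. This function is
finitely supported, equals `1` on `A`, and satisfies `h_n ≤ P h_n` off `A`, where `P` averages over
the neighbours. Cheeger's inequality
`cheeger_inequality` for the Dirichlet form therefore gives
`c |A| ≤ c ‖h_n‖² ≤ ∑_{x ∈ A} deg(x) (1 - P h_n(x))`, and the right-hand side tends to `cap(A)`.
Thus `cap(A) ≥ c |A|` (`card_le_capacity`), and harmonic measure gives every vertex a mass of at
most `C / |A|` (`harmonicMeasure_le`).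

Consider now the weight `W_t = ∑_{x ∈ A_t} exp(dist(o, x))`. A vertex of `∂A_t` weighs at most `e`
times as much as a neighbour in `A_t`, and it is chosen with probability at most `C / (t + 1)`, so
that `E[W_{t+1} | A_t] ≤ (1 + C D e / (t + 1)) W_t` (`tsum_dlaTransition_mul_expWeight_le`). Hence
`E[W_t]` grows polynomially in `t`. As `exp(rad(A_t)) ≤ W_t`, Markov's inequality and the
Borel–Cantelli lemma bound `rad(A_t)` by a multiple of `log t`.
-/

noncomputable section

namespace DLA

/-! ### Balls and outer boundaries -/

section Graph

variable {V : Type*} (G : SimpleGraph V) [G.LocallyFinite]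

open Classical in
/-- The closed neighbourhood `A ∪ ∂A` of a finite set of vertices. -/
def thicken (A : Finset V) : Finset V :=
  A ∪ outerBoundary G A

theorem subset_thicken (A : Finset V) : A ⊆ thicken G A := by
  classical
  exact Finset.subset_union_left

theorem mem_thicken_of_adj {A : Finset V} {x y : V} (hy : y ∈ A) (h : G.Adj x y) :
    x ∈ thicken G A := by
  classical
  by_cases hx : x ∈ A
  · exact subset_thicken G A hx
  · exact Finset.mem_union_right _ ((mem_outerBoundary G).2 ⟨hx, y, hy, h⟩)

theorem card_thicken_le {D : ℕ} (hD : ∀ x, G.degree x ≤ D) (A : Finset V) :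
    (thicken G A).card ≤ (D + 1) * A.card := by
  classical
  have h1 : (outerBoundary G A).card ≤ A.card * D :=
    (Finset.card_le_card Finset.sdiff_subset).trans
      (Finset.card_biUnion_le_card_mul _ _ _ fun x _ => by simpa using hD x)
  calc (thicken G A).card ≤ A.card + (outerBoundary G A).card := Finset.card_union_le _ _
    _ ≤ (D + 1) * A.card := by linarith

theorem card_iterate_thicken_le {D : ℕ} (hD : ∀ x, G.degree x ≤ D) (A : Finset V) (n : ℕ) :
    ((thicken G)^[n] A).card ≤ (D + 1) ^ n * A.card := by
  induction n with
  | zero => simp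
  | succ n ih =>
    rw [Function.iterate_succ_apply']
    calc _ ≤ (D + 1) * ((thicken G)^[n] A).card := card_thicken_le G hD _
      _ ≤ (D + 1) * ((D + 1) ^ n * A.card) := Nat.mul_le_mul_left _ ih
      _ = _ := by ring

theorem mem_iterate_thicken_of_walk {o x : V} (p : G.Walk x o) {n : ℕ} (hn : p.length ≤ n) :
    x ∈ (thicken G)^[n] {o} := by
  induction n generalizing x with
  | zero =>
    have := SimpleGraph.Walk.eq_of_length_eq_zero (Nat.le_zero.1 hn)
    simp [this]
  | succ n ih =>
    rw [Function.iterate_succ_apply']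
    cases p with
    | nil => exact subset_thicken G _ (ih .nil (by simp))
    | cons h q =>
      exact mem_thicken_of_adj G (ih q (by simpa using hn)) h

theorem mem_iterate_thicken_of_dist_le (hconn : G.Connected) {o x : V} {n : ℕ}
    (hn : G.dist o x ≤ n) : x ∈ (thicken G)^[n] {o} := by
  obtain ⟨p, hp⟩ := hconn.exists_walk_length_eq_dist x o
  exact mem_iterate_thicken_of_walk G p (by rw [hp, G.dist_comm]; exact hn)

/-- A connected locally finite graph is the increasing union of its finite balls. -/
theorem countable_of_connected (hconn : G.Connected) (o : V) : Countable V := by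
  rw [← Set.countable_univ_iff]
  refine (Set.countable_iUnion fun n : ℕ => ((thicken G)^[n] {o}).countable_toSet).mono ?_
  intro x _
  exact Set.mem_iUnion.2 ⟨_, mem_iterate_thicken_of_dist_le G hconn le_rfl⟩

theorem card_le_pow_rad (hconn : G.Connected) {D : ℕ} (hD : ∀ x, G.degree x ≤ D) (o : V)
    (A : Finset V) : A.card ≤ (D + 1) ^ rad G o A := by
  have h : A ⊆ (thicken G)^[rad G o A] {o} := fun x hx =>
    mem_iterate_thicken_of_dist_le G hconn (Finset.le_sup (f := fun x => G.dist o x) hx)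
  simpa using (Finset.card_le_card h).trans (card_iterate_thicken_le G hD _ _)

end Graph

/-! ### The isoperimetric inequality in `ℓ¹` and in `ℓ²` -/

section Cheeger

variable {V : Type*} (G : SimpleGraph V) [G.LocallyFinite]

theorem cheegerConstant_mul_card_le (A : Finset V) :
    cheegerConstant G * A.card ≤ (outerBoundary G A).card := by
  rcases A.eq_empty_or_nonempty with rfl | hA
  · simp
  · have hpos : (0 : ℝ) < A.card := by exact_mod_cast hA.card_pos
    rw [← le_div_iff₀ hpos]
    exact ciInf_le (f := fun A : {A : Finset V // A.Nonempty} =>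
      ((outerBoundary G A.1).card : ℝ) / (A.1.card : ℝ))
      ⟨0, by rintro _ ⟨B, rfl⟩; positivity⟩ ⟨A, hA⟩

open Classical in
theorem card_outerBoundary_le_sum (A : Finset V) :
    ((outerBoundary G A).card : ℝ) ≤
      ∑ x ∈ A, ∑ y ∈ G.neighborFinset x, if y ∈ A then (0 : ℝ) else 1 := by
  have h : outerBoundary G A ⊆ A.biUnion fun x => (G.neighborFinset x).filter (· ∉ A) := by
    intro y hy
    obtain ⟨hyA, x, hx, hxy⟩ := (mem_outerBoundary G).1 hy
    simp only [Finset.mem_biUnion, Finset.mem_filter, SimpleGraph.mem_neighborFinset]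
    exact ⟨x, hx, hxy.symm, hyA⟩
  have h2 := (Finset.card_le_card h).trans Finset.card_biUnion_le
  calc ((outerBoundary G A).card : ℝ)
      ≤ ∑ x ∈ A, (((G.neighborFinset x).filter (· ∉ A)).card : ℝ) := by exact_mod_cast h2
    _ = _ := by
      refine Finset.sum_congr rfl fun x _ => ?_
      rw [Finset.card_filter]
      push_cast
      exact Finset.sum_congr rfl fun y _ => by by_cases hy : y ∈ A <;> simp [hy]

/-- The isoperimetric inequality in functional form. Subtracting from `g` its smallest value on
`S` makes the support smaller and accounts for the boundary of `S` itself, which is a discrete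
version of the co-area formula. -/
theorem cheegerConstant_mul_sum_le (S : Finset V) (g : V → ℝ) (hg : ∀ x, 0 ≤ g x)
    (hS : ∀ x ∉ S, g x = 0) :
    cheegerConstant G * ∑ x ∈ S, g x ≤
      ∑ x ∈ S, ∑ y ∈ G.neighborFinset x, max (g x - g y) 0 := by
  classical
  induction S using Finset.strongInduction generalizing g with
  | H S ih =>
  rcases S.eq_empty_or_nonempty with rfl | hne
  · simp
  obtain ⟨z, hz, hmin⟩ := Finset.exists_min_image S g hne
  set g' : V → ℝ := fun x => if x ∈ S then g x - g z else 0 with hg'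
  have hg'0 : ∀ x, 0 ≤ g' x := by
    intro x
    by_cases hx : x ∈ S
    · simpa [hg', hx] using hmin x hx
    · simp [hg', hx]
  have hgz : g' z = 0 := by simp [hg']
  have key := ih (S.erase z) (Finset.erase_ssubset hz) g' hg'0 (by
    intro x hx
    by_cases hxz : x = z
    · rw [hxz, hgz]
    · have : x ∉ S := fun h => hx (Finset.mem_erase.2 ⟨hxz, h⟩)
      simp [hg', this])
  have e1 : ∑ x ∈ S, g x = ∑ x ∈ S.erase z, g' x + g z * S.card := by
    rw [Finset.sum_erase _ hgz, mul_comm, ← nsmul_eq_mul, ← Finset.sum_const,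
      ← Finset.sum_add_distrib]
    exact Finset.sum_congr rfl fun x hx => by simp [hg', hx]
  have e2 : ∑ x ∈ S.erase z, ∑ y ∈ G.neighborFinset x, max (g' x - g' y) 0
      = ∑ x ∈ S, ∑ y ∈ G.neighborFinset x, max (g' x - g' y) 0 := by
    refine Finset.sum_erase _ (Finset.sum_eq_zero fun y _ => ?_)
    rw [hgz]
    exact max_eq_right (by linarith [hg'0 y])
  have e3 : ∑ x ∈ S, ∑ y ∈ G.neighborFinset x, max (g x - g y) 0
      = ∑ x ∈ S, ∑ y ∈ G.neighborFinset x, max (g' x - g' y) 0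
        + g z * ∑ x ∈ S, ∑ y ∈ G.neighborFinset x, if y ∈ S then (0 : ℝ) else 1 := by
    rw [Finset.mul_sum, ← Finset.sum_add_distrib]
    refine Finset.sum_congr rfl fun x hx => ?_
    rw [Finset.mul_sum, ← Finset.sum_add_distrib]
    refine Finset.sum_congr rfl fun y _ => ?_
    have h1 := hmin x hx
    by_cases hy : y ∈ S
    · simp [hg', hx, hy]
    · simp [hg', hx, hy, hS y hy, hg x, h1]
  rw [e1, e3, ← e2, mul_add]
  have h4 := (cheegerConstant_mul_card_le G S).trans (card_outerBoundary_le_sum G S)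
  have h5 := mul_le_mul_of_nonneg_left h4 (hg z)
  linarith

/-- Edges that leave the support `S` of `φ` are counted on the right-hand side only. -/
theorem sum_sum_neighborFinset_le (S : Finset V) (φ : V → ℝ) (hφ : ∀ x, 0 ≤ φ x)
    (hS : ∀ x ∉ S, φ x = 0) :
    ∑ x ∈ S, ∑ y ∈ G.neighborFinset x, φ y ≤ ∑ y ∈ S, (G.degree y : ℝ) * φ y := by
  classical
  have h1 : ∀ x, ∑ y ∈ G.neighborFinset x, φ y = ∑ y ∈ S, if G.Adj y x then φ y else 0 := by
    intro x
    rw [← Finset.sum_filter]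
    refine (Finset.sum_subset_zero_on_sdiff ?_ ?_ fun _ _ => rfl).symm
    · intro y hy
      simpa using (Finset.mem_filter.1 hy).2.symm
    · intro y hy
      simp only [Finset.mem_sdiff, SimpleGraph.mem_neighborFinset, Finset.mem_filter] at hy
      exact hS y fun h => hy.2 ⟨h, hy.1.symm⟩
  simp_rw [h1]
  rw [Finset.sum_comm]
  refine Finset.sum_le_sum fun y _ => ?_
  rw [← Finset.sum_filter, Finset.sum_const, nsmul_eq_mul]
  refine mul_le_mul_of_nonneg_right ?_ (hφ y)
  rw [← G.card_neighborFinset_eq_degree]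
  exact_mod_cast Finset.card_le_card fun x hx => by simpa using (Finset.mem_filter.1 hx).2

/-- Cheeger's inequality: non-amenability bounds the Dirichlet form from below by the `ℓ²`-norm.
It follows from the `ℓ¹`-inequality for `f²` and the inequality of arithmetic and geometric
means. -/
theorem cheeger_inequality {D : ℕ} (hD : ∀ x, G.degree x ≤ D) (hD0 : 0 < D)
    (hG : IsNonamenable G) (S : Finset V) (f : V → ℝ) (hS : ∀ x ∉ S, f x = 0) :
    cheegerConstant G ^ 2 / (8 * D) * ∑ x ∈ S, f x ^ 2 ≤
      ∑ x ∈ S, f x * ∑ y ∈ G.neighborFinset x, (f x - f y) := by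
  have hΦ : 0 < cheegerConstant G := hG
  set Φ := cheegerConstant G
  have hDr : (0 : ℝ) < D := by exact_mod_cast hD0
  set N := ∑ x ∈ S, f x ^ 2 with hN
  set R := ∑ x ∈ S, f x * ∑ y ∈ G.neighborFinset x, (f x - f y) with hR
  have hL1 := cheegerConstant_mul_sum_le G S (fun x => f x ^ 2) (fun x => sq_nonneg _)
    (fun x hx => by simp [hS x hx])
  have hswap := sum_sum_neighborFinset_le G S (fun x => f x ^ 2) (fun x => sq_nonneg _)
    (fun x hx => by simp [hS x hx])
  set T := ∑ x ∈ S, ∑ y ∈ G.neighborFinset x, f y ^ 2 with hT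
  set U := ∑ y ∈ S, (G.degree y : ℝ) * f y ^ 2 with hU
  have hU' : U = ∑ x ∈ S, ∑ y ∈ G.neighborFinset x, f x ^ 2 := by simp [hU]
  have hUN : U ≤ D * N := by
    rw [hU, hN, Finset.mul_sum]
    exact Finset.sum_le_sum fun x _ =>
      mul_le_mul_of_nonneg_right (by exact_mod_cast hD x) (sq_nonneg _)
  set Q := ∑ x ∈ S, ∑ y ∈ G.neighborFinset x, (f x - f y) ^ 2 with hQ
  have hQR : Q = 2 * R + (T - U) := by
    rw [hQ, hR, hT, hU', Finset.mul_sum, ← Finset.sum_sub_distrib, ← Finset.sum_add_distrib]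
    refine Finset.sum_congr rfl fun x _ => ?_
    rw [← mul_assoc, Finset.mul_sum, ← Finset.sum_sub_distrib, ← Finset.sum_add_distrib]
    exact Finset.sum_congr rfl fun y _ => by ring
  have hmax : ∑ x ∈ S, ∑ y ∈ G.neighborFinset x, max (f x ^ 2 - f y ^ 2) 0 ≤
      2 * D / Φ * Q + Φ / (4 * D) * (U + T) := by
    rw [hQ, hT, hU', ← Finset.sum_add_distrib, Finset.mul_sum, Finset.mul_sum,
      ← Finset.sum_add_distrib]
    refine Finset.sum_le_sum fun x _ => ?_
    rw [← Finset.sum_add_distrib, Finset.mul_sum, Finset.mul_sum, ← Finset.sum_add_distrib]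
    refine Finset.sum_le_sum fun y _ => max_le ?_ (by positivity)
    -- With `k = 4 * D / Φ` the bound is `u * v ≤ k / 2 * u ^ 2 + (1 / (2 * k)) * v ^ 2` for
    -- `u = f x - f y` and `v = f x + f y`; for this `k` the last terms sum to at most `Φ / 2 * N`.
    have hε : 0 < 4 * D / Φ := by positivity
    have e : Φ / (4 * D) = (4 * D / Φ)⁻¹ := by rw [inv_div]
    have e' : 2 * D / Φ = 4 * D / Φ / 2 := by ring
    rw [e, e']
    set k := 4 * D / Φ
    have hkk : k * k⁻¹ = 1 := mul_inv_cancel₀ hε.ne'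
    have hk' : 0 < k⁻¹ := inv_pos.2 hε
    have : 0 ≤ k⁻¹ * (k * (f x - f y) - (f x + f y)) ^ 2 := by positivity
    have e4 : k⁻¹ * (k * (f x - f y) - (f x + f y)) ^ 2 =
        (k * k⁻¹) * k * (f x - f y) ^ 2 - 2 * (k * k⁻¹) * (f x ^ 2 - f y ^ 2)
          + k⁻¹ * (f x + f y) ^ 2 := by ring
    rw [e4, hkk] at this
    have h5 : 0 ≤ k⁻¹ * (f x - f y) ^ 2 := by positivity
    nlinarith
  have h6 : Φ / (4 * D) * (U + T) ≤ Φ / 2 * N := by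
    calc _ ≤ Φ / (4 * D) * (2 * (D * N)) := by gcongr; linarith
      _ = _ := by field_simp; ring
  have h7 : 2 * D / Φ * Q ≤ 4 * D / Φ * R := by
    calc _ ≤ 2 * D / Φ * (2 * R) := by gcongr; linarith
      _ = _ := by ring
  have h8 : Φ / 2 * N ≤ 4 * D / Φ * R := by linarith
  calc Φ ^ 2 / (8 * D) * N = Φ / (4 * D) * (Φ / 2 * N) := by field_simp; ring
    _ ≤ Φ / (4 * D) * (4 * D / Φ * R) := by gcongr
    _ = R := by field_simp

end Cheeger

/-! ### Hitting probabilities in finite time -/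

section Hitting

variable {V : Type*} (G : SimpleGraph V) [G.LocallyFinite]

/-- The average of `f` over the neighbours of `x`, that is, the transition operator of the simple
random walk applied to `f`. -/
def neighborAverage (f : V → ℝ) (x : V) : ℝ :=
  (G.degree x : ℝ)⁻¹ * ∑ y ∈ G.neighborFinset x, f y

open Classical in
/-- The probability that the simple random walk from `x` visits `A` during the times `0, …, n`,
defined by its first-step recursion. -/
def hitWithin (A : Finset V) : ℕ → V → ℝ
  | 0, x => if x ∈ A then 1 else 0
  | n + 1, x => if x ∈ A then 1 else neighborAverage G (hitWithin A n) x

theorem degree_mul_neighborAverage (f : V → ℝ) (x : V) :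
    (G.degree x : ℝ) * neighborAverage G f x = ∑ y ∈ G.neighborFinset x, f y := by
  rw [neighborAverage, ← mul_assoc]
  by_cases h : G.degree x = 0
  · have : G.neighborFinset x = ∅ := by
      rwa [← Finset.card_eq_zero, G.card_neighborFinset_eq_degree]
    simp [this]
  · rw [mul_inv_cancel₀ (by exact_mod_cast h), one_mul]

theorem neighborAverage_mono {f g : V → ℝ} (h : ∀ x, f x ≤ g x) (x : V) :
    neighborAverage G f x ≤ neighborAverage G g x :=
  mul_le_mul_of_nonneg_left (Finset.sum_le_sum fun y _ => h y) (by positivity)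

theorem neighborAverage_nonneg {f : V → ℝ} (h : ∀ x, 0 ≤ f x) (x : V) :
    0 ≤ neighborAverage G f x :=
  mul_nonneg (by positivity) (Finset.sum_nonneg fun y _ => h y)

theorem neighborAverage_le_one {f : V → ℝ} (h : ∀ x, f x ≤ 1) (x : V) :
    neighborAverage G f x ≤ 1 := by
  refine (neighborAverage_mono G h x).trans ?_
  simpa [neighborAverage] using inv_mul_le_one (a := (G.degree x : ℝ))

theorem neighborAverage_one_sub {x : V} (hx : 0 < G.degree x) (f : V → ℝ) :
    neighborAverage G (fun y => 1 - f y) x = 1 - neighborAverage G f x := by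
  have : (G.degree x : ℝ) ≠ 0 := by exact_mod_cast hx.ne'
  simp only [neighborAverage, Finset.sum_sub_distrib, mul_sub]
  simp [this]

variable (A : Finset V)

theorem hitWithin_of_mem {x : V} (hx : x ∈ A) (n : ℕ) : hitWithin G A n x = 1 := by
  cases n <;> simp [hitWithin, hx]

theorem hitWithin_succ_of_notMem {x : V} (hx : x ∉ A) (n : ℕ) :
    hitWithin G A (n + 1) x = neighborAverage G (hitWithin G A n) x := by
  simp [hitWithin, hx]

theorem hitWithin_nonneg (n : ℕ) (x : V) : 0 ≤ hitWithin G A n x := by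
  induction n generalizing x with
  | zero => unfold hitWithin; split_ifs <;> simp
  | succ n ih =>
    by_cases hx : x ∈ A
    · simp [hitWithin_of_mem G A hx]
    · rw [hitWithin_succ_of_notMem G A hx]
      exact neighborAverage_nonneg G ih x

theorem hitWithin_le_one (n : ℕ) (x : V) : hitWithin G A n x ≤ 1 := by
  induction n generalizing x with
  | zero => unfold hitWithin; split_ifs <;> simp
  | succ n ih =>
    by_cases hx : x ∈ A
    · simp [hitWithin_of_mem G A hx]
    · rw [hitWithin_succ_of_notMem G A hx]
      exact neighborAverage_le_one G ih x

/-- Monotonicity in `n`; off `A` it says that `hitWithin G A n` is subharmonic. -/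
theorem hitWithin_le_succ (n : ℕ) (x : V) : hitWithin G A n x ≤ hitWithin G A (n + 1) x := by
  induction n generalizing x with
  | zero =>
    by_cases hx : x ∈ A
    · simp [hitWithin_of_mem G A hx]
    · simpa [hitWithin, hx] using hitWithin_nonneg G A 1 x
  | succ n ih =>
    by_cases hx : x ∈ A
    · simp [hitWithin_of_mem G A hx]
    · rw [hitWithin_succ_of_notMem G A hx, hitWithin_succ_of_notMem G A hx]
      exact neighborAverage_mono G ih x

theorem hitWithin_eq_zero {n : ℕ} {x : V} (hx : x ∉ (thicken G)^[n] A) :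
    hitWithin G A n x = 0 := by
  induction n generalizing x with
  | zero =>
    have hx' : x ∉ A := hx
    simp [hitWithin, hx']
  | succ n ih =>
    rw [Function.iterate_succ_apply'] at hx
    have hsub : ∀ m, A ⊆ (thicken G)^[m] A := by
      intro m
      induction m with
      | zero => simp
      | succ m ihm =>
        rw [Function.iterate_succ_apply']
        exact ihm.trans (subset_thicken G _)
    have hxA : x ∉ A := fun h => hx (subset_thicken G _ (hsub n h))
    rw [hitWithin_succ_of_notMem G A hxA, neighborAverage, Finset.sum_eq_zero, mul_zero]
    intro y hy
    refine ih fun hy' => hx (mem_thicken_of_adj G hy' ?_)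
    simpa using hy

/-- The finite-time form of the lower bound for the capacity. The function `hitWithin G A n` is
finitely supported, equals `1` on `A`, and is subharmonic off `A`, so that its Dirichlet form is
at most the flux out of `A`. -/
theorem card_le_sum_degree_mul_one_sub {D : ℕ} (hD : ∀ x, G.degree x ≤ D) (hD0 : 0 < D)
    (hG : IsNonamenable G) (n : ℕ) :
    cheegerConstant G ^ 2 / (8 * D) * A.card ≤
      ∑ x ∈ A, (G.degree x : ℝ) * (1 - neighborAverage G (hitWithin G A n) x) := by
  classical
  set h := hitWithin G A n with hh
  set S := A ∪ (thicken G)^[n] A with hS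
  have hAS : A ⊆ S := Finset.subset_union_left
  have h1 := cheeger_inequality G hD hD0 hG S h fun x hx =>
    hitWithin_eq_zero G A fun h' => hx (Finset.mem_union_right _ h')
  have h2 : (A.card : ℝ) ≤ ∑ x ∈ S, h x ^ 2 := by
    calc (A.card : ℝ) = ∑ x ∈ A, h x ^ 2 := by
          rw [Finset.sum_congr rfl fun x hx => by rw [hh, hitWithin_of_mem G A hx]]
          simp
      _ ≤ _ := Finset.sum_le_sum_of_subset_of_nonneg hAS fun _ _ _ => sq_nonneg _
  have h3 : ∀ x, ∑ y ∈ G.neighborFinset x, (h x - h y) =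
      (G.degree x : ℝ) * (h x - neighborAverage G h x) := by
    intro x
    rw [mul_sub, degree_mul_neighborAverage, Finset.sum_sub_distrib]
    simp
  refine (mul_le_mul_of_nonneg_left h2 (by positivity)).trans (h1.trans ?_)
  rw [← Finset.sum_sdiff hAS]
  have h4 : ∑ x ∈ S \ A, h x * ∑ y ∈ G.neighborFinset x, (h x - h y) ≤ 0 := by
    refine Finset.sum_nonpos fun x hx => ?_
    have hx' := (Finset.mem_sdiff.1 hx).2
    have h5 := hitWithin_le_succ G A n x
    rw [hitWithin_succ_of_notMem G A hx'] at h5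
    rw [h3]
    exact mul_nonpos_of_nonneg_of_nonpos (hitWithin_nonneg G A n x)
      (mul_nonpos_of_nonneg_of_nonpos (by positivity) (sub_nonpos.2 h5))
  have h6 : ∑ x ∈ A, h x * ∑ y ∈ G.neighborFinset x, (h x - h y) =
      ∑ x ∈ A, (G.degree x : ℝ) * (1 - neighborAverage G h x) := by
    refine Finset.sum_congr rfl fun x hx => ?_
    have : h x = 1 := hitWithin_of_mem G A hx n
    rw [h3, this, one_mul]
  linarith

/-- The event that the path `X` avoids `A` during the times `1, …, n`. -/
def avoids (n : ℕ) : Set (ℕ → V) :=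
  {X | ∀ t, 1 ≤ t → t ≤ n → X t ∉ A}

theorem mem_avoids_succ {A : Finset V} {n : ℕ} {X : ℕ → V} :
    X ∈ avoids A (n + 1) ↔ X ∈ avoids A n ∧ X (n + 1) ∉ A := by
  simp only [avoids, Set.mem_ofPred_eq]
  constructor
  · exact fun h => ⟨fun t h1 h2 => h t h1 (by omega), h _ (by omega) le_rfl⟩
  · rintro ⟨h1, h2⟩ t ht htn
    rcases Nat.lt_or_ge n t with h3 | h3
    · rwa [show t = n + 1 by omega]
    · exact h1 t ht h3

theorem setOf_returnTime_eq_top :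
    {X : ℕ → V | returnTime A X = ⊤} = ⋂ n, avoids A (n + 1) := by
  ext X
  simp only [returnTime, Set.mem_ofPred_eq, iInf_eq_top, ENat.natCast_ne_top, imp_false, not_and,
    Set.mem_iInter, avoids]
  exact ⟨fun h n t ht _ => h t ht, fun h t ht => h t t ht (by omega)⟩

end Hitting

/-! ### Escape probabilities and the capacity -/

section Capacity

open scoped ENNReal

variable {V : Type*} (G : SimpleGraph V) [G.LocallyFinite]
  [MeasurableSpace V] [DiscreteMeasurableSpace V]

theorem lintegral_walkKernel [Countable V] {x : V} (hx : 0 < G.degree x) {f : V → ℝ}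
    (hf : ∀ y, 0 ≤ f y) :
    ∫⁻ y, ENNReal.ofReal (f y) ∂(walkKernel G x) = ENNReal.ofReal (neighborAverage G f x) := by
  classical
  have hne : (G.neighborFinset x).Nonempty := by
    rwa [← Finset.card_pos, G.card_neighborFinset_eq_degree]
  have hw : walkStep G x = PMF.uniformOfFinset (G.neighborFinset x) hne := by
    simp [walkStep, hne]
  change ∫⁻ y, ENNReal.ofReal (f y) ∂(walkStep G x).toMeasure = _
  rw [lintegral_countable', hw, tsum_eq_sum (s := G.neighborFinset x)]
  · rw [neighborAverage, ENNReal.ofReal_mul (by positivity),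
      ENNReal.ofReal_sum_of_nonneg fun y _ => hf y, Finset.mul_sum]
    refine Finset.sum_congr rfl fun y hy => ?_
    rw [PMF.toMeasure_apply_singleton _ _ (measurableSet_singleton y),
      PMF.uniformOfFinset_apply_of_mem hne hy, mul_comm, G.card_neighborFinset_eq_degree,
      ENNReal.ofReal_inv_of_pos (by exact_mod_cast hx), ENNReal.ofReal_natCast]
  · intro y hy
    rw [PMF.toMeasure_apply_singleton _ _ (measurableSet_singleton y),
      PMF.uniformOfFinset_apply_of_notMem hne hy, mul_zero]

instance (x : V) : IsProbabilityMeasure (walkLaw G x) := by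
  unfold walkLaw
  infer_instance

theorem lintegral_walkLaw_zero (x : V) (g : V → ℝ≥0∞) :
    ∫⁻ X, g (X 0) ∂(walkLaw G x) = g x := by
  have hg : Measurable g := Measurable.of_discrete
  rw [walkLaw, Kernel.lintegral_traj (X := fun _ => V) (κ := walkHistoryKernel G) _
    (f := fun X => g (X 0)) (hg.comp (measurable_pi_apply 0))]
  simp [Function.updateFinset]

/-- The Markov property of the simple random walk at the last step. -/
theorem lintegral_walkLaw_succ (x : V) (n : ℕ) {F : (Finset.Iic n → V) → ℝ≥0∞}
    (hF : Measurable F) (g : V → ℝ≥0∞) :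
    ∫⁻ X, F (Preorder.frestrictLe (π := fun _ => V) n X) * g (X (n + 1)) ∂(walkLaw G x) =
      ∫⁻ X, F (Preorder.frestrictLe (π := fun _ => V) n X) *
        ∫⁻ y, g y ∂(walkKernel G (X n)) ∂(walkLaw G x) := by
  have hg : Measurable g := Measurable.of_discrete
  have key := Kernel.partialTraj_compProd_eq_map_traj (X := fun _ => V)
    (κ := walkHistoryKernel G) (Nat.zero_le n) (x₀ := fun _ => x)
  have hprod : Measurable fun p : (Finset.Iic n → V) × V => F p.1 * g p.2 :=
    (hF.comp measurable_fst).mul (hg.comp measurable_snd)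
  have hinner : Measurable fun y : V => ∫⁻ z, g z ∂(walkKernel G y) := Measurable.of_discrete
  have hlast : Measurable fun h : Finset.Iic n → V =>
      ∫⁻ z, g z ∂(walkKernel G (h ⟨n, Finset.mem_Iic.2 le_rfl⟩)) :=
    hinner.comp (measurable_pi_apply _)
  have h1 : ∫⁻ X, F (Preorder.frestrictLe (π := fun _ => V) n X) * g (X (n + 1)) ∂(walkLaw G x)
      = ∫⁻ p, F p.1 * g p.2 ∂((walkLaw G x).map
          fun X => (Preorder.frestrictLe (π := fun _ => V) n X, X (n + 1))) := by
    rw [lintegral_map hprod (by fun_prop)]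
  rw [h1, walkLaw, ← key, Measure.lintegral_compProd hprod,
    ← Kernel.traj_map_frestrictLe_apply, lintegral_map _ (Preorder.measurable_frestrictLe n)]
  · refine lintegral_congr fun X => ?_
    simp only
    rw [lintegral_const_mul _ hg]
    rfl
  · have : (fun h : (i : Finset.Iic n) → (fun _ : ℕ => V) i =>
        ∫⁻ b, F (h, b).1 * g (h, b).2 ∂(walkHistoryKernel G n h)) =
        fun h => F h * ∫⁻ z, g z ∂(walkKernel G (h ⟨n, Finset.mem_Iic.2 le_rfl⟩)) := by
      funext h
      simp only
      rw [lintegral_const_mul _ hg]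
      rfl
    rw [this]
    exact hF.mul hlast

theorem measurableSet_avoids (A : Finset V) (n : ℕ) : MeasurableSet (avoids A n) := by
  have : avoids A n = ⋂ (t : ℕ) (_ : 1 ≤ t) (_ : t ≤ n), (fun X : ℕ → V => X t) ⁻¹' (↑A)ᶜ := by
    ext X
    simp [avoids]
  rw [this]
  exact .iInter fun t => .iInter fun _ => .iInter fun _ =>
    measurable_pi_apply t (MeasurableSet.of_discrete)

theorem lintegral_indicator_avoids_succ (A : Finset V) (x : V) (n : ℕ) (g : V → ℝ≥0∞) :
    ∫⁻ X, (avoids A n).indicator 1 X * g (X (n + 1)) ∂(walkLaw G x) =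
      ∫⁻ X, (avoids A n).indicator 1 X * ∫⁻ y, g y ∂(walkKernel G (X n)) ∂(walkLaw G x) := by
  set E : Set (Finset.Iic n → V) := {h | ∀ t, 1 ≤ t.1 → h t ∉ A} with hE
  have hEm : MeasurableSet E := by
    have : E = ⋂ (t : Finset.Iic n) (_ : 1 ≤ t.1),
        (fun h : Finset.Iic n → V => h t) ⁻¹' (↑A)ᶜ := by
      ext h
      simp [hE]
    rw [this]
    exact .iInter fun t => .iInter fun _ => measurable_pi_apply t (MeasurableSet.of_discrete)
  have h1 : ∀ X : ℕ → V, (avoids A n).indicator (1 : (ℕ → V) → ℝ≥0∞) X =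
      E.indicator 1 (Preorder.frestrictLe (π := fun _ => V) n X) := by
    intro X
    have : X ∈ avoids A n ↔ Preorder.frestrictLe (π := fun _ => V) n X ∈ E := by
      simp only [avoids, hE, Set.mem_ofPred_eq, Preorder.frestrictLe_apply]
      exact ⟨fun h t ht => h t.1 ht (Finset.mem_Iic.1 t.2),
        fun h t ht htn => h ⟨t, Finset.mem_Iic.2 htn⟩ ht⟩
    by_cases hX : X ∈ avoids A n
    · simp [hX, this.1 hX]
    · simp [hX, mt this.2 hX]
  simp_rw [h1]
  exact lintegral_walkLaw_succ G x n (measurable_one.indicator hEm) g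

theorem lintegral_one_sub_hitWithin [Countable V] (hdeg : ∀ x, 0 < G.degree x) (A : Finset V)
    (x : V) (n k : ℕ) :
    ∫⁻ X, (avoids A n).indicator 1 X * ENNReal.ofReal (1 - hitWithin G A k (X (n + 1)))
        ∂(walkLaw G x) =
      ∫⁻ X, (avoids A n).indicator 1 X *
        ENNReal.ofReal (1 - neighborAverage G (hitWithin G A k) (X n)) ∂(walkLaw G x) := by
  rw [lintegral_indicator_avoids_succ G A x n
    (fun y => ENNReal.ofReal (1 - hitWithin G A k y))]
  refine lintegral_congr fun X => ?_
  rw [lintegral_walkKernel G (hdeg _) fun y => sub_nonneg.2 (hitWithin_le_one G A k y),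
    neighborAverage_one_sub G (hdeg _)]

/-- The probability of avoiding `A` during the times `1, …, n + k + 1`, computed from the position
at time `n`. Induction on `n` moves one step at a time from the path to the function, so that only
the Markov property at the last step is needed. -/
theorem lintegral_avoids [Countable V] (hdeg : ∀ x, 0 < G.degree x) (A : Finset V) (x : V)
    (n k : ℕ) :
    ∫⁻ X, (avoids A n).indicator 1 X *
        ENNReal.ofReal (1 - neighborAverage G (hitWithin G A k) (X n)) ∂(walkLaw G x) =
      ENNReal.ofReal (1 - neighborAverage G (hitWithin G A (n + k)) x) := by
  induction n generalizing k with
  | zero =>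
    have : avoids A 0 = Set.univ := by
      ext X
      simp only [avoids, Set.mem_ofPred_eq, Set.mem_univ, iff_true]
      omega
    simp only [this, Set.indicator_univ, Pi.one_apply, one_mul, zero_add]
    exact lintegral_walkLaw_zero G x
      (fun y => ENNReal.ofReal (1 - neighborAverage G (hitWithin G A k) y))
  | succ n ih =>
    rw [show n + 1 + k = n + (k + 1) by omega, ← ih (k + 1),
      ← lintegral_one_sub_hitWithin G hdeg A x n (k + 1)]
    refine lintegral_congr fun X => ?_
    by_cases hA : X (n + 1) ∈ A
    · rw [hitWithin_of_mem G A hA]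
      simp [mem_avoids_succ, hA]
    · rw [hitWithin_succ_of_notMem G A hA]
      by_cases hX : X ∈ avoids A n
      · simp [mem_avoids_succ, hA, hX]
      · simp [mem_avoids_succ, hX]

/-- The identification of the recursively defined `hitWithin` with the law of the walk. -/
theorem walkLaw_avoids_succ [Countable V] (hdeg : ∀ x, 0 < G.degree x) (A : Finset V) (x : V)
    (n : ℕ) :
    walkLaw G x (avoids A (n + 1)) =
      ENNReal.ofReal (1 - neighborAverage G (hitWithin G A n) x) := by
  have h0 := lintegral_avoids G hdeg A x n 0
  rw [← lintegral_one_sub_hitWithin G hdeg, add_zero] at h0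
  rw [← h0, ← lintegral_indicator_one (measurableSet_avoids A (n + 1))]
  refine lintegral_congr fun X => ?_
  by_cases hA : X (n + 1) ∈ A
  · simp [mem_avoids_succ, hA, hitWithin]
  · by_cases hX : X ∈ avoids A n
    · simp [mem_avoids_succ, hA, hX, hitWithin]
    · simp [mem_avoids_succ, hX]

theorem tendsto_escape [Countable V] (hdeg : ∀ x, 0 < G.degree x) (A : Finset V) (x : V) :
    Tendsto (fun n => 1 - neighborAverage G (hitWithin G A n) x) atTop
      (nhds ((walkLaw G x).real {X | returnTime A X = ⊤})) := by
  have h1 : Tendsto (fun n => walkLaw G x (avoids A (n + 1))) atTop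
      (nhds (walkLaw G x {X | returnTime A X = ⊤})) := by
    rw [setOf_returnTime_eq_top]
    refine tendsto_measure_iInter_atTop
      (fun n => (measurableSet_avoids A _).nullMeasurableSet) ?_ ⟨0, measure_ne_top _ _⟩
    intro m n hmn X hX t ht htm
    exact hX t ht (by omega)
  have h2 := (ENNReal.tendsto_toReal (measure_ne_top _ _)).comp h1
  refine h2.congr fun n => ?_
  rw [Function.comp_apply, walkLaw_avoids_succ G hdeg, ENNReal.toReal_ofReal]
  exact sub_nonneg.2 (neighborAverage_le_one G (hitWithin_le_one G A n) x)

/-- On a non-amenable graph of bounded degree the capacity is at least linear in the volume. -/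
theorem card_le_capacity [Countable V] (hdeg : ∀ x, 0 < G.degree x) {D : ℕ}
    (hD : ∀ x, G.degree x ≤ D) (hD0 : 0 < D) (hG : IsNonamenable G) (A : Finset V) :
    cheegerConstant G ^ 2 / (8 * D) * A.card ≤ capacity G A := by
  have h1 : Tendsto (fun n => ∑ x ∈ A,
      (G.degree x : ℝ) * (1 - neighborAverage G (hitWithin G A n) x)) atTop
      (nhds (capacity G A)) := by
    refine tendsto_finsetSum _ fun x hx => ?_
    simp only [equilibriumMeasure, hx, if_true]
    exact (tendsto_escape G hdeg A x).const_mul _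
  exact ge_of_tendsto' h1 fun n => card_le_sum_degree_mul_one_sub G A hD hD0 hG n

/-! ### Harmonic measure -/

theorem equilibriumMeasure_nonneg (A : Finset V) (x : V) : 0 ≤ equilibriumMeasure G A x := by
  unfold equilibriumMeasure
  split_ifs <;> positivity

theorem equilibriumMeasure_le_degree (A : Finset V) (x : V) :
    equilibriumMeasure G A x ≤ G.degree x := by
  unfold equilibriumMeasure
  split_ifs
  · exact mul_le_of_le_one_right (by positivity) measureReal_le_one
  · positivity

theorem capacity_nonneg (A : Finset V) : 0 ≤ capacity G A :=
  Finset.sum_nonneg fun x _ => equilibriumMeasure_nonneg G A x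

theorem harmonicMeasure_nonneg (A : Finset V) (x : V) : 0 ≤ harmonicMeasure G A x :=
  div_nonneg (equilibriumMeasure_nonneg G A x) (capacity_nonneg G A)

theorem sum_harmonicMeasure_le_one {A B : Finset V} (h : B ⊆ A) :
    ∑ x ∈ B, harmonicMeasure G A x ≤ 1 := by
  refine (Finset.sum_le_sum_of_subset_of_nonneg h fun x _ _ =>
    harmonicMeasure_nonneg G A x).trans ?_
  simp only [harmonicMeasure, ← Finset.sum_div]
  exact div_self_le_one _

/-- On a non-amenable graph of bounded degree, harmonic measure from infinity charges every vertex
by at most a constant over the volume. -/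
theorem harmonicMeasure_le [Countable V] (hdeg : ∀ x, 0 < G.degree x) {D : ℕ}
    (hD : ∀ x, G.degree x ≤ D) (hD0 : 0 < D) (hG : IsNonamenable G) {A : Finset V}
    (hA : A.Nonempty) (x : V) :
    harmonicMeasure G A x ≤ D / (cheegerConstant G ^ 2 / (8 * D)) / A.card := by
  have hΦ : 0 < cheegerConstant G := hG
  have hDr : (0 : ℝ) < D := by exact_mod_cast hD0
  have hcard : (0 : ℝ) < A.card := by exact_mod_cast hA.card_pos
  rw [div_div]
  exact div_le_div₀ hDr.le ((equilibriumMeasure_le_degree G A x).trans (by exact_mod_cast hD x))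
    (by positivity) (card_le_capacity G hdeg hD hD0 hG A)

end Capacity

/-! ### The exponential moment of the aggregate -/

section Aggregation

open scoped ENNReal

variable {V : Type*} (G : SimpleGraph V)

/-- The weight `∑_{x ∈ S} exp(dist(o, x))` of a finite set of vertices. -/
def expWeight (o : V) (S : Finset V) : ℝ :=
  ∑ x ∈ S, Real.exp (G.dist o x)

theorem expWeight_nonneg (o : V) (S : Finset V) : 0 ≤ expWeight G o S :=
  Finset.sum_nonneg fun _ _ => (Real.exp_pos _).le

theorem exp_rad_le_expWeight (o : V) {S : Finset V} (hS : S.Nonempty) :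
    Real.exp (rad G o S) ≤ expWeight G o S := by
  obtain ⟨x, hx, hmax⟩ := Finset.exists_mem_eq_sup S hS fun x => G.dist o x
  rw [rad, hmax]
  exact Finset.single_le_sum (f := fun x => Real.exp (G.dist o x))
    (fun _ _ => (Real.exp_pos _).le) hx

variable [G.LocallyFinite]

theorem expWeight_outerBoundary_le (hconn : G.Connected) {D : ℕ} (hD : ∀ x, G.degree x ≤ D)
    (o : V) (S : Finset V) :
    expWeight G o (outerBoundary G S) ≤ D * Real.exp 1 * expWeight G o S := by
  classical
  calc expWeight G o (outerBoundary G S)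
      ≤ ∑ x ∈ outerBoundary G S, ∑ y ∈ S,
          if G.Adj y x then Real.exp 1 * Real.exp (G.dist o y) else 0 := by
        refine Finset.sum_le_sum fun x hx => ?_
        obtain ⟨-, y, hy, hxy⟩ := (mem_outerBoundary G).1 hx
        have h1 : G.dist o x ≤ 1 + G.dist o y := by
          have := hconn.dist_triangle (u := o) (v := y) (w := x)
          rwa [SimpleGraph.dist_eq_one_iff_adj.2 hxy.symm, add_comm] at this
        have h2 : Real.exp (G.dist o x) ≤ Real.exp 1 * Real.exp (G.dist o y) := by
          rw [← Real.exp_add]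
          exact Real.exp_le_exp.2 (by exact_mod_cast h1)
        refine h2.trans ?_
        have := Finset.single_le_sum (s := S) (a := y)
          (f := fun y => if G.Adj y x then Real.exp 1 * Real.exp (G.dist o y) else 0)
          (fun _ _ => by split_ifs <;> positivity) hy
        simpa [hxy.symm] using this
    _ = ∑ y ∈ S, ∑ x ∈ outerBoundary G S with G.Adj y x,
          Real.exp 1 * Real.exp (G.dist o y) := by
        rw [Finset.sum_comm]
        simp_rw [Finset.sum_filter]
    _ ≤ ∑ y ∈ S, D * Real.exp 1 * Real.exp (G.dist o y) := by
        refine Finset.sum_le_sum fun y _ => ?_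
        rw [Finset.sum_const, nsmul_eq_mul, ← mul_assoc]
        gcongr
        refine le_trans (Finset.card_le_card fun x hx => ?_)
          ((G.card_neighborFinset_eq_degree y).le.trans (hD y))
        simpa using (Finset.mem_filter.1 hx).2
    _ = _ := by rw [expWeight, Finset.mul_sum]

variable [MeasurableSpace V] [DiscreteMeasurableSpace V]

theorem exists_insert_of_dlaTransition_ne_zero {S T : Finset V} (h : dlaTransition G S T ≠ 0) :
    S ⊆ T ∧ T.card = S.card + 1 := by
  classical
  obtain ⟨x, hx, -⟩ := Finset.exists_ne_zero_of_sum_ne_zero h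
  obtain ⟨hx1, rfl⟩ := Finset.mem_filter.1 hx
  have hxS := ((mem_outerBoundary G).1 hx1).1
  convert! And.intro (Finset.subset_insert x S) (Finset.card_insert_of_notMem hxS)

/-- The expectation of a nonnegative function after one transition. -/
theorem tsum_dlaTransition_mul (S : Finset V) {w : Finset V → ℝ} (hw : ∀ T, 0 ≤ w T) :
    ∑' T, ENNReal.ofReal (dlaTransition G S T) * ENNReal.ofReal (w T) =
      open Classical in
      ENNReal.ofReal (∑ x ∈ outerBoundary G S,
        harmonicMeasure G (S ∪ outerBoundary G S) x * w (insert x S)) := by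
  classical
  set H := fun x => harmonicMeasure G (S ∪ outerBoundary G S) x with hH
  have hH0 : ∀ x, 0 ≤ H x := fun x => harmonicMeasure_nonneg G _ x
  have h1 : ∀ T, ENNReal.ofReal (dlaTransition G S T) * ENNReal.ofReal (w T) =
      ∑ x ∈ outerBoundary G S,
        if insert x S = T then ENNReal.ofReal (H x * w (insert x S)) else 0 := by
    intro T
    have e : dlaTransition G S T = ∑ x ∈ outerBoundary G S, if insert x S = T then H x else 0 := by
      rw [← Finset.sum_filter, dlaTransition]
    rw [e, ← ENNReal.ofReal_mul' (hw T), Finset.sum_mul, ENNReal.ofReal_sum_of_nonneg]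
    · refine Finset.sum_congr rfl fun x _ => ?_
      split_ifs with h
      · rw [h]
      · simp
    · intro x _
      split_ifs
      · exact mul_nonneg (hH0 x) (hw T)
      · simp
  simp_rw [h1]
  rw [Summable.tsum_finsetSum fun _ _ => ENNReal.summable]
  rw [ENNReal.ofReal_sum_of_nonneg]
  · refine Finset.sum_congr rfl fun x _ => ?_
    rw [tsum_eq_single (insert x S) fun T hT => by simp [hT.symm]]
    simp only [if_true, hH]
  · intro x _
    exact mul_nonneg (harmonicMeasure_nonneg G _ x) (hw _)

/-- The mean growth of the exponential weight in one step: a vertex added next to `y` weighs at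
most `e` times as much as `y`, and each is added with probability `O(1 / |S|)`. -/
theorem tsum_dlaTransition_mul_expWeight_le [Countable V] (hconn : G.Connected)
    (hdeg : ∀ x, 0 < G.degree x) {D : ℕ} (hD : ∀ x, G.degree x ≤ D) (hD0 : 0 < D)
    (hG : IsNonamenable G) (o : V) {S : Finset V} (hS : S.Nonempty) :
    ∑' T, ENNReal.ofReal (dlaTransition G S T) * ENNReal.ofReal (expWeight G o T) ≤
      ENNReal.ofReal (1 + D / (cheegerConstant G ^ 2 / (8 * D)) * (D * Real.exp 1) / S.card) *
        ENNReal.ofReal (expWeight G o S) := by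
  classical
  have hΦ : 0 < cheegerConstant G := hG
  have hDr : (0 : ℝ) < D := by exact_mod_cast hD0
  have hcard : (0 : ℝ) < S.card := by exact_mod_cast hS.card_pos
  rw [tsum_dlaTransition_mul G S (expWeight_nonneg G o), ← ENNReal.ofReal_mul (by positivity)]
  refine ENNReal.ofReal_le_ofReal ?_
  set B : Finset V := thicken G S
  set K : ℝ := D / (cheegerConstant G ^ 2 / (8 * D)) with hK
  have hbd : outerBoundary G S ⊆ B := by
    intro x hx
    obtain ⟨-, y, hy, hxy⟩ := (mem_outerBoundary G).1 hx
    exact mem_thicken_of_adj G hy hxy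
  have hSB : S ⊆ B := subset_thicken G S
  have hle : ∀ x, harmonicMeasure G B x ≤ K / S.card := fun x => by
    refine (harmonicMeasure_le G hdeg hD hD0 hG (hS.mono hSB) x).trans ?_
    have := Finset.card_le_card hSB
    gcongr
  have h1 : ∀ x ∈ outerBoundary G S,
      harmonicMeasure G B x * expWeight G o (insert x S) ≤
        harmonicMeasure G B x * expWeight G o S + K / S.card * Real.exp (G.dist o x) := by
    intro x hx
    have hxS := ((mem_outerBoundary G).1 hx).1
    have e : expWeight G o (insert x S) = Real.exp (G.dist o x) + expWeight G o S := by
      rw [expWeight, Finset.sum_insert hxS, expWeight]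
    rw [e, mul_add, add_comm]
    gcongr
    exact hle x
  have h2 : ∑ x ∈ outerBoundary G S, harmonicMeasure G B x * expWeight G o (insert x S) ≤
      1 * expWeight G o S + K / S.card * (D * Real.exp 1 * expWeight G o S) := by
    refine (Finset.sum_le_sum h1).trans ?_
    rw [Finset.sum_add_distrib, ← Finset.sum_mul, ← Finset.mul_sum]
    refine add_le_add ?_ ?_
    · exact mul_le_mul_of_nonneg_right (sum_harmonicMeasure_le_one G hbd)
        (expWeight_nonneg G o S)
    · exact mul_le_mul_of_nonneg_left (expWeight_outerBoundary_le G hconn hD o S) (by positivity)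
  calc _ = ∑ x ∈ outerBoundary G S, harmonicMeasure G B x * expWeight G o (insert x S) := by
        convert! rfl
    _ ≤ _ := h2
    _ = _ := by ring

end Aggregation

/-! ### The one-dimensional laws of the chain -/

section Chain

open scoped ENNReal

variable {V : Type*} {G : SimpleGraph V} [G.LocallyFinite]
  [MeasurableSpace V] [DiscreteMeasurableSpace V] [Countable V] {S₀ : Finset V}
  {Ω : Type*} [MeasurableSpace Ω] {μ : Measure Ω} {A : ℕ → Ω → Finset V}

theorem IsDLA.lintegral_eq_tsum (hA : IsDLA G S₀ μ A) (t : ℕ) (w : Finset V → ℝ≥0∞) :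
    ∫⁻ ω, w (A t ω) ∂μ = ∑' S, μ {ω | A t ω = S} * w S := by
  let _ : MeasurableSpace (Finset V) := ⊤
  have hmeas : Measurable (A t) := measurable_to_countable' fun S => hA.measurableSet_eq t S
  rw [← lintegral_map (f := w) (measurable_from_top) hmeas, lintegral_countable']
  refine tsum_congr fun S => ?_
  rw [Measure.map_apply hmeas (MeasurableSpace.measurableSet_top), mul_comm]
  rfl

theorem IsDLA.measurable_comp (hA : IsDLA G S₀ μ A) (t : ℕ) (w : Finset V → ℝ≥0∞) :
    Measurable fun ω => w (A t ω) := by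
  let _ : MeasurableSpace (Finset V) := ⊤
  have hmeas : Measurable (A t) := measurable_to_countable' fun S => hA.measurableSet_eq t S
  exact (measurable_from_top (f := w)).comp hmeas

variable [IsProbabilityMeasure μ]

/-- The two-point form of the Markov property, by summation over the histories. -/
theorem IsDLA.measure_eq_and_eq_succ (hA : IsDLA G S₀ μ A) (t : ℕ) (S T : Finset V) :
    μ {ω | A t ω = S ∧ A (t + 1) ω = T} =
      μ {ω | A t ω = S} * ENNReal.ofReal (dlaTransition G S T) := by
  -- `hist H i` extends a history `H` before time `t` by `S` at time `t` and `T` afterwards.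
  set hist : (Fin t → Finset V) → ℕ → Finset V := fun H i =>
    if h : i < t then H ⟨i, h⟩ else if i = t then S else T with hhist
  have hlt : ∀ (H : Fin t → Finset V) (i : Fin t), hist H i = H i := fun H i => by
    simp [hhist]
  have ht : ∀ H, hist H t = S := fun H => by simp [hhist]
  have hst : ∀ H, hist H (t + 1) = T := fun H => by simp [hhist]
  have hmeas : ∀ n H, MeasurableSet {ω | ∀ i ≤ n, A i ω = hist H i} := fun n H => by
    have : {ω | ∀ i ≤ n, A i ω = hist H i} = ⋂ (i : ℕ) (_ : i ≤ n), {ω | A i ω = hist H i} := by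
      ext ω
      simp
    rw [this]
    exact .iInter fun i => .iInter fun _ => hA.measurableSet_eq i _
  have hdisj : ∀ n, t ≤ n → Pairwise fun H H' : Fin t → Finset V =>
      Disjoint {ω | ∀ i ≤ n, A i ω = hist H i} {ω | ∀ i ≤ n, A i ω = hist H' i} := by
    intro n hn H H' hne
    refine Set.disjoint_left.2 fun ω h1 h2 => hne (funext fun i => ?_)
    have hi : (i : ℕ) ≤ n := i.2.le.trans hn
    rw [← hlt H i, ← hlt H' i, ← h1 i hi, ← h2 i hi]
  have hU1 : {ω | A t ω = S} = ⋃ H : Fin t → Finset V, {ω | ∀ i ≤ t, A i ω = hist H i} := by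
    ext ω
    simp only [Set.mem_ofPred_eq, Set.mem_iUnion]
    constructor
    · intro h
      refine ⟨fun i => A i ω, fun i hi => ?_⟩
      rcases hi.lt_or_eq with h1 | h1
      · exact (hlt (fun i => A i ω) ⟨i, h1⟩).symm
      · rw [h1]
        exact h.trans (ht fun i => A i ω).symm
    · rintro ⟨H, hH⟩
      rw [hH t le_rfl, ht]
  have hU2 : {ω | A t ω = S ∧ A (t + 1) ω = T} =
      ⋃ H : Fin t → Finset V, {ω | ∀ i ≤ t + 1, A i ω = hist H i} := by
    ext ω
    simp only [Set.mem_ofPred_eq, Set.mem_iUnion]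
    constructor
    · intro h
      refine ⟨fun i => A i ω, fun i hi => ?_⟩
      rcases hi.lt_or_eq with h1 | h1
      · rcases (Nat.lt_succ_iff.1 h1).lt_or_eq with h2 | h2
        · exact (hlt (fun i => A i ω) ⟨i, h2⟩).symm
        · rw [h2]
          exact h.1.trans (ht fun i => A i ω).symm
      · rw [h1]
        exact h.2.trans (hst fun i => A i ω).symm
    · rintro ⟨H, hH⟩
      exact ⟨by rw [hH t (by omega), ht], by rw [hH (t + 1) le_rfl, hst]⟩
  rw [hU1, hU2, measure_iUnion (hdisj t le_rfl) (hmeas t),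
    measure_iUnion (hdisj (t + 1) (by omega)) (hmeas (t + 1)), ← ENNReal.tsum_mul_right]
  refine tsum_congr fun H => ?_
  have := hA.markov t (hist H)
  rw [ht, hst, measureReal_def, measureReal_def] at this
  rw [← ENNReal.ofReal_toReal (measure_ne_top μ {ω | ∀ i ≤ t + 1, A i ω = hist H i}), this,
    ENNReal.ofReal_mul ENNReal.toReal_nonneg, ENNReal.ofReal_toReal (measure_ne_top _ _)]

theorem IsDLA.measure_eq_succ (hA : IsDLA G S₀ μ A) (t : ℕ) (T : Finset V) :
    μ {ω | A (t + 1) ω = T} =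
      ∑' S, μ {ω | A t ω = S} * ENNReal.ofReal (dlaTransition G S T) := by
  have h : {ω | A (t + 1) ω = T} = ⋃ S, {ω | A t ω = S ∧ A (t + 1) ω = T} := by
    ext ω
    simp
  rw [h, measure_iUnion]
  · exact tsum_congr fun S => hA.measure_eq_and_eq_succ t S T
  · exact fun S S' hne => Set.disjoint_left.2 fun ω h1 h2 => hne (h1.1.symm.trans h2.1)
  · exact fun S => (hA.measurableSet_eq t S).inter (hA.measurableSet_eq (t + 1) T)

/-- Almost surely every step adds exactly one vertex. -/
theorem IsDLA.ae_card (hA : IsDLA G S₀ μ A) (t : ℕ) :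
    ∀ᵐ ω ∂μ, S₀ ⊆ A t ω ∧ (A t ω).card = S₀.card + t := by
  induction t with
  | zero =>
    filter_upwards [hA.start] with ω hω
    simp [hω]
  | succ t ih =>
    have h : ∀ᵐ ω ∂μ, ∀ S T : Finset V, dlaTransition G S T = 0 →
        ¬ (A t ω = S ∧ A (t + 1) ω = T) := by
      rw [ae_all_iff]
      intro S
      rw [ae_all_iff]
      intro T
      by_cases h0 : dlaTransition G S T = 0
      · have := hA.measure_eq_and_eq_succ t S T
        rw [h0, ENNReal.ofReal_zero, mul_zero] at this
        filter_upwards [measure_eq_zero_iff_ae_notMem.1 this] with ω hω _ using hω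
      · exact .of_forall fun ω h1 => absurd h1 h0
    filter_upwards [ih, h] with ω h1 h2
    have h3 := exists_insert_of_dlaTransition_ne_zero G fun h0 =>
      h2 (A t ω) (A (t + 1) ω) h0 ⟨rfl, rfl⟩
    exact ⟨h1.1.trans h3.1, by rw [h3.2, h1.2]; ring⟩

theorem IsDLA.lintegral_succ (hA : IsDLA G S₀ μ A) (t : ℕ) (w : Finset V → ℝ≥0∞) :
    ∫⁻ ω, w (A (t + 1) ω) ∂μ =
      ∑' S, μ {ω | A t ω = S} * ∑' T, ENNReal.ofReal (dlaTransition G S T) * w T := by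
  rw [hA.lintegral_eq_tsum]
  simp_rw [hA.measure_eq_succ, ← ENNReal.tsum_mul_right, ← ENNReal.tsum_mul_left]
  rw [ENNReal.tsum_comm]
  simp_rw [mul_assoc]

end Chain

/-! ### Logarithmic growth of the radius -/

section Growth

open scoped ENNReal

variable {V : Type*} {G : SimpleGraph V} [G.LocallyFinite]
  [MeasurableSpace V] [DiscreteMeasurableSpace V] [Countable V]
  {Ω : Type*} [MeasurableSpace Ω] {μ : Measure Ω} [IsProbabilityMeasure μ]
  {A : ℕ → Ω → Finset V}

/-- The exponential weight of the aggregate has polynomial growth in mean, since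
`∏ (1 + a / (s + 1)) ≤ exp (a ∑ 1 / (s + 1))`. -/
theorem IsDLA.exists_lintegral_expWeight_le (hconn : G.Connected)
    (hdeg : ∀ x, 0 < G.degree x) {D : ℕ} (hD : ∀ x, G.degree x ≤ D) (hD0 : 0 < D)
    (hG : IsNonamenable G) (o : V) (hA : IsDLA G {o} μ A) :
    ∃ a : ℝ, ∀ t : ℕ, ∫⁻ ω, ENNReal.ofReal (expWeight G o (A t ω)) ∂μ ≤
      ENNReal.ofReal (Real.exp (a * harmonic t)) := by
  have hΦ : 0 < cheegerConstant G := hG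
  have hDr : (0 : ℝ) < D := by exact_mod_cast hD0
  refine ⟨D / (cheegerConstant G ^ 2 / (8 * D)) * (D * Real.exp 1), fun t => ?_⟩
  induction t with
  | zero =>
    have : ∫⁻ ω, ENNReal.ofReal (expWeight G o (A 0 ω)) ∂μ = ∫⁻ _, 1 ∂μ := by
      refine lintegral_congr_ae ?_
      filter_upwards [hA.start] with ω hω
      simp [hω, expWeight]
    simp [this]
  | succ t ih =>
    set a := D / (cheegerConstant G ^ 2 / (8 * D)) * (D * Real.exp 1) with ha
    rw [hA.lintegral_succ t fun S => ENNReal.ofReal (expWeight G o S)]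
    calc _ ≤ ∑' S, μ {ω | A t ω = S} *
          (ENNReal.ofReal (1 + a / (t + 1)) * ENNReal.ofReal (expWeight G o S)) := by
          refine ENNReal.tsum_le_tsum fun S => ?_
          by_cases h0 : μ {ω | A t ω = S} = 0
          · simp [h0]
          · obtain ⟨ω, hω, h1⟩ : ∃ ω, A t ω = S ∧
                ({o} ⊆ A t ω ∧ (A t ω).card = ({o} : Finset V).card + t) := by
              by_contra! hcon
              refine h0 (measure_eq_zero_iff_ae_notMem.2 ?_)
              filter_upwards [hA.ae_card t] with ω h2 h3
              exact hcon ω h3 h2.1 h2.2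
            rw [hω] at h1
            have hne : S.Nonempty := ⟨o, h1.1 (by simp)⟩
            have h4 := tsum_dlaTransition_mul_expWeight_le G hconn hdeg hD hD0 hG o hne
            rw [h1.2] at h4
            have e : (((({o} : Finset V).card + t : ℕ)) : ℝ) = t + 1 := by
              push_cast [Finset.card_singleton]
              ring
            rw [e] at h4
            exact mul_le_mul_right h4 _
      _ = ENNReal.ofReal (1 + a / (t + 1)) *
          ∫⁻ ω, ENNReal.ofReal (expWeight G o (A t ω)) ∂μ := by
          rw [hA.lintegral_eq_tsum t fun S => ENNReal.ofReal (expWeight G o S),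
            ← ENNReal.tsum_mul_left]
          exact tsum_congr fun S => by ring
      _ ≤ ENNReal.ofReal (Real.exp (a / (t + 1))) *
          ENNReal.ofReal (Real.exp (a * harmonic t)) := by
          gcongr
          rw [add_comm]
          exact Real.add_one_le_exp _
      _ = _ := by
          rw [← ENNReal.ofReal_mul (Real.exp_pos _).le, ← Real.exp_add, harmonic_succ]
          congr 2
          push_cast
          rw [div_eq_mul_inv]
          ring

/-- The upper bound for the radius: Markov's inequality for the exponential weight and the
Borel–Cantelli lemma. -/
theorem IsDLA.exists_ae_eventually_rad_le (hconn : G.Connected)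
    (hdeg : ∀ x, 0 < G.degree x) {D : ℕ} (hD : ∀ x, G.degree x ≤ D) (hD0 : 0 < D)
    (hG : IsNonamenable G) (o : V) (hA : IsDLA G {o} μ A) :
    ∃ K : ℝ, ∀ᵐ ω ∂μ, ∀ᶠ t : ℕ in atTop, (rad G o (A t ω) : ℝ) ≤ K * Real.log t := by
  obtain ⟨a, ha⟩ := hA.exists_lintegral_expWeight_le hconn hdeg hD hD0 hG o
  -- Replacing `a` by `|a|` allows `harmonic t ≤ 1 + log t`; the extra `2` gives a summable bound.
  refine ⟨|a| + 2, ?_⟩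
  have hbound : ∀ t : ℕ, 1 ≤ t →
      μ {ω | (|a| + 2) * Real.log t < rad G o (A t ω)} ≤
        ENNReal.ofReal (Real.exp |a| * (1 / (t : ℝ) ^ 2)) := by
    intro t ht
    have htr : (0 : ℝ) < t := by exact_mod_cast ht
    set r := Real.exp ((|a| + 2) * Real.log t) with hr
    have hr0 : 0 < r := Real.exp_pos _
    have h1 : μ {ω | (|a| + 2) * Real.log t < rad G o (A t ω)} ≤
        μ {ω | ENNReal.ofReal r ≤ ENNReal.ofReal (expWeight G o (A t ω))} := by
      refine measure_mono_ae ?_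
      filter_upwards [hA.ae_card t] with ω hω h
      refine ENNReal.ofReal_le_ofReal ?_
      exact (Real.exp_le_exp.2 (le_of_lt h)).trans
        (exp_rad_le_expWeight G o ⟨o, hω.1 (by simp)⟩)
    have h2 := mul_meas_ge_le_lintegral (μ := μ)
      (hA.measurable_comp t fun S => ENNReal.ofReal (expWeight G o S)) (ENNReal.ofReal r)
    have h3 : ENNReal.ofReal r * μ {ω | (|a| + 2) * Real.log t < rad G o (A t ω)} ≤
        ENNReal.ofReal (Real.exp (a * harmonic t)) :=
      (mul_le_mul_right h1 _).trans (h2.trans (ha t))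
    have h4 : Real.exp (a * harmonic t) ≤ r * (Real.exp |a| * (1 / (t : ℝ) ^ 2)) := by
      have e : (1 / (t : ℝ) ^ 2) = Real.exp (-(2 * Real.log t)) := by
        rw [Real.exp_neg, mul_comm, Real.exp_mul, Real.exp_log htr]
        norm_num
      rw [e, hr, ← Real.exp_add, ← Real.exp_add]
      refine Real.exp_le_exp.2 ?_
      have hh := harmonic_le_one_add_log t
      have hh0 : (0 : ℝ) ≤ harmonic t := by
        rcases Nat.eq_zero_or_pos t with h | h
        · simp [h]
        · exact_mod_cast (harmonic_pos h.ne').le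
      calc a * harmonic t ≤ |a| * harmonic t := mul_le_mul_of_nonneg_right (le_abs_self a) hh0
        _ ≤ |a| * (1 + Real.log t) := mul_le_mul_of_nonneg_left hh (abs_nonneg a)
        _ = _ := by ring
    have h5 := h3.trans (ENNReal.ofReal_le_ofReal h4)
    rw [ENNReal.ofReal_mul hr0.le] at h5
    exact (ENNReal.mul_le_mul_iff_right (by simpa using hr0) ENNReal.ofReal_ne_top).1 h5
  have hsum : ∑' t : ℕ, μ {ω | (|a| + 2) * Real.log (t + 1 : ℕ) < rad G o (A (t + 1) ω)} ≠ ∞ := by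
    refine ne_top_of_le_ne_top ?_ (ENNReal.tsum_le_tsum fun t => hbound (t + 1) (by omega))
    have hs : Summable fun t : ℕ => Real.exp |a| * (1 / ((t + 1 : ℕ) : ℝ) ^ 2) :=
      ((summable_nat_add_iff (f := fun n : ℕ => 1 / (n : ℝ) ^ 2) 1).2
        (Real.summable_one_div_nat_pow.2 one_lt_two)).mul_left _
    rw [← ENNReal.ofReal_tsum_of_nonneg (fun t => by positivity) hs]
    exact ENNReal.ofReal_ne_top
  filter_upwards [ae_eventually_notMem hsum] with ω hω
  rw [← map_add_atTop_eq_nat 1, eventually_map]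
  filter_upwards [hω] with t ht
  simpa using ht

end Growth

end DLA

end

theorem mainTheorem3 {V : Type*} [Infinite V] [MeasurableSpace V] [DiscreteMeasurableSpace V]
    (G : SimpleGraph V) [G.LocallyFinite] (hconn : G.Connected)
    (hdeg : ∃ D : ℕ, ∀ x : V, G.degree x ≤ D) (hG : DLA.IsNonamenable G) (o : V)
    {Ω : Type*} [MeasurableSpace Ω] (μ : Measure Ω) [IsProbabilityMeasure μ]
    (A : ℕ → Ω → Finset V) (hA : DLA.IsDLA G {o} μ A) :
    ∀ᵐ ω ∂μ,
      (0 : EReal) < ⨅ (t : ℕ) (_ : 1 < t),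
          (((Real.log t)⁻¹ * (DLA.rad G o (A t ω) : ℝ) : ℝ) : EReal) ∧
      (⨅ (t : ℕ) (_ : 1 < t), (((Real.log t)⁻¹ * (DLA.rad G o (A t ω) : ℝ) : ℝ) : EReal)) ≤
          limsup (fun t : ℕ => (((Real.log t)⁻¹ * (DLA.rad G o (A t ω) : ℝ) : ℝ) : EReal)) atTop ∧
      limsup (fun t : ℕ => (((Real.log t)⁻¹ * (DLA.rad G o (A t ω) : ℝ) : ℝ) : EReal)) atTop
          < ⊤ := by
  obtain ⟨D, hD⟩ := hdeg
  have hpos : ∀ x, 0 < G.degree x := fun x => hconn.preconnected.degree_pos_of_nontrivial x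
  have hD0 : 0 < D := (hpos o).trans_le (hD o)
  have : Countable V := DLA.countable_of_connected G hconn o
  obtain ⟨K, hK⟩ := hA.exists_ae_eventually_rad_le hconn hpos hD hD0 hG o
  filter_upwards [ae_all_iff.2 hA.ae_card, hK] with ω hcard hrad
  have hlogt : ∀ t : ℕ, 1 < t → 0 < Real.log t := fun t ht =>
    Real.log_pos (by exact_mod_cast ht)
  refine ⟨?_, ?_, ?_⟩
  · have hlogD : 0 < Real.log (D + 1) := Real.log_pos (by
      have : (0 : ℝ) < D := by exact_mod_cast hD0
      linarith)
    have hlow : (((Real.log (D + 1))⁻¹ : ℝ) : EReal) ≤ ⨅ (t : ℕ) (_ : 1 < t),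
        (((Real.log t)⁻¹ * (DLA.rad G o (A t ω) : ℝ) : ℝ) : EReal) := by
      refine le_iInf₂ fun t ht => EReal.coe_le_coe_iff.2 ?_
      have h1 : t ≤ (D + 1) ^ DLA.rad G o (A t ω) := by
        refine le_trans ?_ (DLA.card_le_pow_rad G hconn hD o (A t ω))
        rw [(hcard t).2]
        omega
      have h2 : Real.log t ≤ DLA.rad G o (A t ω) * Real.log (D + 1) := by
        rw [← Real.log_pow]
        exact Real.log_le_log (by exact_mod_cast (by omega : 0 < t)) (by exact_mod_cast h1)
      rw [inv_mul_eq_div, le_div_iff₀ (hlogt t ht), inv_mul_le_iff₀ hlogD]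
      linarith
    exact (EReal.coe_pos.2 (inv_pos.2 hlogD)).trans_le hlow
  · refine le_limsup_of_frequently_le (Eventually.frequently ?_)
    filter_upwards [eventually_gt_atTop 1] with t ht using iInf₂_le t ht
  · refine lt_of_le_of_lt (limsup_le_of_le (a := ((K : ℝ) : EReal)) (h := ?_)) (EReal.coe_lt_top K)
    filter_upwards [hrad, eventually_gt_atTop 1] with t ht h1
    rw [EReal.coe_le_coe_iff, inv_mul_le_iff₀ (hlogt t h1), mul_comm]
    exact ht
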